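/- Fix $N_0>0$ and consider the AWGN channel $Y_j = X_j + Z_j$, $j=1,2,\ldots$, where the $Z_j$ are i.i.d. $\mathcal N(0,N_0/2)$ and independent of the message. A non-feedback $(E,\epsilon)$ code for a random variable $W$ with values in $\mathcal W$ consists of encoders $\mathsf f_j:\mathcal W\to\mathbb R$, $X_j=\mathsf f_j(W)$, with $\sum_{j\ge1}X_j^2\le E$ almost surely, and a decoder $\mathsf g:\mathbb R^\infty\to\mathcal W$, $\widehat W=\mathsf g(Y_1,Y_2,\ldots)$, with $\mathbb P[\widehat W\ne W]\le\epsilon$. With $Q$ the standard normal complementary distribution function, denote for $E>0$ and integers $m\ge1$ $$\varepsilon(E,m)=1-\frac1{\sqrt{\pi N_0}}\int_{-\infty}^{\infty}\left(1-Q\left(\frac{x+\sqrt E}{\sqrt{N_0/2}}\right)\right)^{m-1}e^{-x^2/N_0}\,dx .$$ Theorem. Let $E_1,E_2>0$ with $E_1+E_2\le E$, and let $W$ be a random variable taking values in $\{1,\ldots,M\}$. Then there exists an $(E,\epsilon)$ non-feedback code for the transmission of $W$ over the AWGN channel such that $$\epsilon\le\mathbb E[\varepsilon(E_1,W)]+\varepsilon(E_2,\lfloor\log_2M\rfloor+1).$$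 Moreover, the code can be chosen to be variable-length separated in the following sense. Represent the message $m$ by its length $\ell=\lfloor\log_2 m\rfloor$ and its index $m-2^{\ell}\in\{0,\ldots,2^\ell-1\}$ within the group of messages of length $\ell$. For some $n$, the first $n$ channel inputs depend on $\ell$ only and have energy at most $E_2$, and the remaining inputs are determined by $\ell$ and the index and have energy at most $E_1$. The decoder computes an estimate $\hat\ell$ of the length from the first $n$ outputs alone, then computes, from $\hat\ell$ and the remaining outputs, an index $\hat k\in\{0,\ldots,2^{\hat\ell}-1\}$, and outputs $2^{\hat\ell}+\hat k$. -/

import Mathlib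

open MeasureTheory ProbabilityTheory

noncomputable section

namespace EnergyLimited

/-- The Gaussian `Q`-function: the complementary distribution function of the standard normal law. -/
def Q (x : ℝ) : ℝ := (gaussianReal 0 1).real (Set.Ioi x)

/-- `ε(E, m)` at noise level `N₀`: the error probability of `m` equal-energy orthogonal signals of
energy `E`, for `m ≥ 1`. -/
def orthErr (N₀ E : ℝ) (m : ℕ) : ℝ :=
  1 - 1 / √(Real.pi * N₀) *
    ∫ x : ℝ, (1 - Q ((x + √E) / √(N₀ / 2))) ^ (m - 1) * Real.exp (-x ^ 2 / N₀)

/-- The law of the noise sequence of the AWGN channel: i.i.d. centred Gaussian of variance `N₀/2`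
in every degree of freedom. -/
def noise (N₀ : ℝ) : Measure (ℕ → ℝ) :=
  Measure.infinitePi fun _ : ℕ => gaussianReal 0 (N₀ / 2).toNNReal

/-- A non-feedback code for messages in `𝓦` over a channel with real inputs and outputs. The input
at channel use `n` is `X n = encoder n W`; the decoder observes the whole infinite output sequence. -/
structure Code (𝓦 : Type*) [MeasurableSpace 𝓦] where
  /-- the sequence of encoding functions -/
  encoder : ℕ → 𝓦 → ℝ
  /-- the decoding function -/
  decoder : (ℕ → ℝ) → 𝓦
  measurable_encoder : ∀ n, Measurable (encoder n)
  measurable_decoder : Measurable decoder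

namespace Code

/-- The channel output sequence `Y = X + Z` for message `w` and noise realization `z`. -/
def output {𝓦 : Type*} [MeasurableSpace 𝓦] (c : Code 𝓦) (w : 𝓦) (z : ℕ → ℝ) : ℕ → ℝ :=
  fun n => c.encoder n w + z n

/-- Maximal energy constraint: `∑ⱼ Xⱼ² ≤ E` with probability one, for `W` distributed as `P`. -/
def EnergyAtMost {𝓦 : Type*} [MeasurableSpace 𝓦] (c : Code 𝓦) (P : Measure 𝓦) (E : ℝ) : Prop :=
  ∀ᵐ w ∂P, Summable (fun j => c.encoder j w ^ 2) ∧ ∑' j, c.encoder j w ^ 2 ≤ E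

/-- The probability that `Ŵ ≠ W`, for `W` distributed as `P` and independent of the AWGN. -/
def errorProb {𝓦 : Type*} [MeasurableSpace 𝓦] (c : Code 𝓦) (P : Measure 𝓦) (N₀ : ℝ) : ℝ :=
  (P.prod (noise N₀)).real {p | c.decoder (c.output p.1 p.2) ≠ p.1}

/-- `c` is an `(E, ε)` non-feedback code for the transmission of `W ∼ P` over the AWGN channel. -/
def IsEnergyErrorCode {𝓦 : Type*} [MeasurableSpace 𝓦] (c : Code 𝓦) (P : Measure 𝓦)
    (N₀ E ε : ℝ) : Prop :=
  c.EnergyAtMost P E ∧ c.errorProb P N₀ ≤ ε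

/-- Variable-length separated codes for messages in `{1, …, M}`. Message `m` is represented by the
binary string with length `ℓ = ⌊log₂ m⌋` and with index `k = m - 2 ^ ℓ` among the strings of that
length. The first `n` channel uses carry a signal that depends on `ℓ` only, of energy at most `E₂`;
the remaining ones carry a signal of energy at most `E₁` from a codebook for the group of strings
of length `ℓ`. The decoder estimates the length from the first `n` outputs alone, and then decides,
from the remaining outputs, among the strings of the estimated length. -/
def IsVariableLengthSeparated {M : ℕ} (c : Code (Set.Icc 1 M)) (E₁ E₂ : ℝ) : Prop :=
  ∃ (n : ℕ) (lenSig : ℕ → ℕ → ℝ) (idxSig : ℕ → ℕ → ℕ → ℝ)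
    (lenDec : (Fin n → ℝ) → ℕ) (idxDec : ℕ → (ℕ → ℝ) → ℕ),
    Measurable lenDec ∧ (∀ l, Measurable (idxDec l)) ∧
    (∀ (m : Set.Icc 1 M) (i : ℕ), i < n → c.encoder i m = lenSig (Nat.log 2 m) i) ∧
    (∀ (m : Set.Icc 1 M) (i : ℕ),
      c.encoder (n + i) m = idxSig (Nat.log 2 m) (m - 2 ^ Nat.log 2 m) i) ∧
    (∀ m : Set.Icc 1 M, ∑ i ∈ Finset.range n, c.encoder i m ^ 2 ≤ E₂) ∧
    (∀ m : Set.Icc 1 M, Summable (fun i => c.encoder (n + i) m ^ 2) ∧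
      ∑' i, c.encoder (n + i) m ^ 2 ≤ E₁) ∧
    (∀ l v, idxDec l v < 2 ^ l) ∧
    ∀ y : ℕ → ℝ,
      (c.decoder y : ℕ) = 2 ^ lenDec (fun i : Fin n => y i) +
        idxDec (lenDec fun i : Fin n => y i) (fun i => y (n + i))

end Code

end EnergyLimited

end

noncomputable section

namespace EnergyLimited

/-! ### The noise sequence and the error probability of orthogonal signals -/

/-! Both the length and the index are sent by pulse position: all the energy goes into one channel
use, and the receiver looks for the strictly largest output. Among `K` positions this fails only on
`confusion E K k`, whose probability is exactly `orthErr N₀ E K` (`noise_real_confusion`).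

The length has `⌊log₂ M⌋ + 1` possible values, which gives the second term. Once the length `l` of
`m` is known, at most `2 ^ l ≤ m` indices compete. Their confusion event lies inside the one for `m`
positions, so the index fails with probability at most `orthErr N₀ E₁ m`. A union bound for each
fixed message (`separatedCode_conditional_error_le`), averaged over `W`, gives the claim. -/

instance isProbabilityMeasure_noise (N₀ : ℝ) : IsProbabilityMeasure (noise N₀) := by
  unfold noise; infer_instance

/-- An injective selection of i.i.d. coordinates has the same law. Hence the index block sees fresh
noise starting at position `0`. -/
lemma noise_map_add_left (N₀ : ℝ) (n : ℕ) :
    (noise N₀).map (fun z i => z (n + i)) = noise N₀ :=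
  Measure.map_infinitePi_infinitePi_of_inj
    (P := fun _ : ℕ => gaussianReal 0 (N₀ / 2).toNNReal) (add_right_injective n)

lemma one_sub_Q (x : ℝ) : 1 - Q x = (gaussianReal 0 1).real (Set.Iic x) := by
  rw [Q, ← Set.compl_Iic, probReal_compl_eq_one_sub measurableSet_Iic]
  ring

lemma gaussianReal_real_Iio {v : NNReal} (hv : v ≠ 0) (t : ℝ) :
    (gaussianReal 0 v).real (Set.Iio t) = 1 - Q (t / √v) := by
  have hs : 0 < √(v : ℝ) := Real.sqrt_pos.2 (by positivity)
  have hmap : (gaussianReal 0 v).map (· / √(v : ℝ)) = gaussianReal 0 1 := by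
    rw [gaussianReal_map_div_const]
    congr 1
    · simp
    · ext
      simp [Real.sq_sqrt, hv]
  have := nullSingletonClass_gaussianReal (μ := 0) hv
  rw [one_sub_Q, ← hmap, map_measureReal_apply (by fun_prop) measurableSet_Iic,
    measureReal_congr Iio_ae_eq_Iic]
  congr 1
  ext x
  simp [div_le_div_iff_of_pos_right hs]

/-- The probability that one coordinate, raised by `c`, strictly exceeds finitely many others. -/
lemma noise_real_forall_lt (N₀ c : ℝ) {a : ℕ} {J : Finset ℕ} (ha : a ∉ J) :
    (noise N₀).real {z | ∀ j ∈ J, z j < c + z a} =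
      ∫ x, (gaussianReal 0 (N₀ / 2).toNNReal).real (Set.Iio (c + x)) ^ J.card
        ∂gaussianReal 0 (N₀ / 2).toNNReal := by
  set γ := gaussianReal 0 (N₀ / 2).toNNReal with hγ
  -- Condition on coordinate `a`: it is independent of the block `J`, so Fubini applies, and given
  -- its value the block contributes a power of a one-dimensional probability.
  have hind : IndepFun (fun z : ℕ → ℝ => z a) (J.restrict) (noise N₀) := by
    have h := (iIndepFun_infinitePi (P := fun _ : ℕ => γ) (X := fun _ x => x)
      (fun _ => measurable_id)).indepFun_finset {a} J (by simpa using ha)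
      (fun i => measurable_pi_apply i)
    have hφ : Measurable fun f : ({a} : Finset ℕ) → ℝ => f ⟨a, by simp⟩ := measurable_pi_apply _
    exact h.comp hφ measurable_id
  have hlaw : (noise N₀).map (fun z => (z a, J.restrict z)) = γ.prod (Measure.pi fun _ : J => γ) := by
    rw [hind.map_prod_eq_prod_map_map (measurable_pi_apply a).aemeasurable
      (Finset.measurable_restrict J).aemeasurable]
    congr 1
    · exact Measure.infinitePi_map_eval (fun _ : ℕ => γ) a
    · exact Measure.infinitePi_map_restrict (fun _ : ℕ => γ)
  have hS : MeasurableSet {p : ℝ × (J → ℝ) | ∀ j, p.2 j < c + p.1} := by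
    rw [Set.ofPred_forall]
    exact MeasurableSet.iInter fun j => measurableSet_lt (by fun_prop) (by fun_prop)
  have hpre : {z : ℕ → ℝ | ∀ j ∈ J, z j < c + z a} =
      (fun z => (z a, J.restrict z)) ⁻¹' {p : ℝ × (J → ℝ) | ∀ j, p.2 j < c + p.1} := by
    ext z; simp
  rw [hpre, ← map_measureReal_apply (by fun_prop) hS, hlaw, measureReal_def,
    Measure.prod_apply hS, ← integral_toReal]
  · congr 1 with x
    have : Prod.mk x ⁻¹' {p : ℝ × (J → ℝ) | ∀ j, p.2 j < c + p.1} =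
        Set.univ.pi fun _ => Set.Iio (c + x) := by
      ext; simp
    rw [this, Measure.pi_pi]
    simp [measureReal_def]
  · exact (measurable_measure_prodMk_left hS).aemeasurable
  · exact Filter.Eventually.of_forall fun x => measure_lt_top _ _

/-- The noise realizations for which some other one of `K` orthogonal signals of energy `E` is at
least as likely as the transmitted one, number `k`. -/
def confusion (E : ℝ) (K k : ℕ) : Set (ℕ → ℝ) :=
  {z | ∃ j < K, j ≠ k ∧ √E + z k ≤ z j}

lemma measurableSet_confusion (E : ℝ) (K k : ℕ) : MeasurableSet (confusion E K k) := by
  have : confusion E K k =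
      ⋃ j, ⋃ (_ : j < K), ⋃ (_ : j ≠ k), {z : ℕ → ℝ | √E + z k ≤ z j} := by
    ext; simp [confusion, and_left_comm]
  rw [this]
  exact .iUnion fun j => .iUnion fun _ => .iUnion fun _ =>
    measurableSet_le (by fun_prop) (by fun_prop)

/-- Ties belong to `confusion`, so its complement is the event that coordinate `k` wins strictly
against the `K - 1` others. This is the source of the exponent in `orthErr`. -/
lemma noise_real_confusion {N₀ : ℝ} (hN₀ : 0 < N₀) (E : ℝ) {K k : ℕ} (hk : k < K) :
    (noise N₀).real (confusion E K k) = orthErr N₀ E K := by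
  have hcompl : (confusion E K k)ᶜ = {z | ∀ j ∈ (Finset.range K).erase k, z j < √E + z k} := by
    ext z
    simp only [confusion, Set.mem_compl_iff, Set.mem_ofPred_eq, Finset.mem_erase, Finset.mem_range]
    push Not
    exact ⟨fun h j hj => h j hj.2 hj.1, fun h j hj hjk => h j ⟨hjk, hj⟩⟩
  have h := probReal_compl_eq_one_sub (μ := noise N₀) (measurableSet_confusion E K k)
  have hv : (N₀ / 2).toNNReal ≠ 0 := by simpa using hN₀
  have hcoe : ((N₀ / 2).toNNReal : ℝ) = N₀ / 2 := Real.coe_toNNReal _ (by positivity)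
  rw [hcompl, noise_real_forall_lt N₀ (√E) (Finset.notMem_erase k _),
    integral_gaussianReal_eq_integral_smul hv] at h
  rw [orthErr, ← integral_const_mul, eq_sub_iff_add_eq, ← eq_sub_iff_add_eq', ← h]
  congr 1 with x
  rw [gaussianReal_real_Iio hv, gaussianPDFReal, hcoe, Finset.card_erase_of_mem (by simpa using hk),
    Finset.card_range, smul_eq_mul, add_comm (√E) x]
  have h2 : 2 * Real.pi * (N₀ / 2) = Real.pi * N₀ := by ring
  have h3 : 2 * (N₀ / 2) = N₀ := by ring
  rw [h2, h3, sub_zero]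
  ring

/-! ### Maximum-likelihood detection of orthogonal signals -/

open scoped Classical in
/-- The position of the strict maximum among the first `K` coordinates, and `0` if there is none. -/
def detect (K : ℕ) (v : ℕ → ℝ) : ℕ :=
  (Finset.range K).sup fun k => if ∀ j < K, j ≠ k → v j < v k then k else 0

lemma detect_le (K : ℕ) (v : ℕ → ℝ) : detect K v ≤ K - 1 := by
  refine Finset.sup_le fun k hk => ?_
  have := Finset.mem_range.1 hk
  split_ifs <;> omega

/-- A strict maximum is unique, so every other term of the supremum is `0`. -/
lemma detect_eq {K k : ℕ} {v : ℕ → ℝ} (hk : k < K) (h : ∀ j < K, j ≠ k → v j < v k) :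
    detect K v = k := by
  apply le_antisymm
  · refine Finset.sup_le fun i hi => ?_
    split_ifs with hi'
    · by_contra hik
      have hne : i ≠ k := by omega
      exact (h i (Finset.mem_range.1 hi) hne).asymm (hi' k hk hne.symm)
    · exact Nat.zero_le k
  · refine le_trans (le_of_eq ?_) (Finset.le_sup (Finset.mem_range.2 hk))
    rw [if_pos h]

lemma detect_congr {K : ℕ} {v w : ℕ → ℝ} (h : ∀ j < K, v j = w j) : detect K v = detect K w := by
  refine Finset.sup_congr rfl fun k hk => ?_
  have hiff : (∀ j < K, j ≠ k → v j < v k) ↔ ∀ j < K, j ≠ k → w j < w k := by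
    refine forall_congr' fun j => forall_congr' fun hj => ?_
    rw [h j hj, h k (Finset.mem_range.1 hk)]
  simp only [hiff]

lemma measurable_detect (K : ℕ) : Measurable (detect K) := by
  classical
  have h : ∀ s : Finset ℕ, Measurable fun v : ℕ → ℝ =>
      s.sup fun k => if ∀ j < K, j ≠ k → v j < v k then k else 0 := by
    intro s
    induction s using Finset.induction_on with
    | empty => simp
    | insert k s _ ih =>
      simp only [Finset.sup_insert]
      refine Measurable.sup (Measurable.ite ?_ measurable_const measurable_const) ih
      simp only [Set.ofPred_forall]
      exact .iInter fun j => .iInter fun _ => .iInter fun _ =>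
        measurableSet_lt (by fun_prop) (by fun_prop)
  unfold detect
  convert! h (Finset.range K)

/-- The `k`-th orthogonal signal of energy `E`. -/
def pulse (E : ℝ) (k i : ℕ) : ℝ := if i = k then √E else 0

lemma hasSum_pulse_sq {E : ℝ} (hE : 0 ≤ E) (k : ℕ) : HasSum (fun i => pulse E k i ^ 2) E := by
  have h := hasSum_ite_eq k E
  refine h.congr_fun fun i => ?_
  unfold pulse
  split_ifs <;> simp [Real.sq_sqrt hE]

/-- Allowing `K' > K` replaces monotonicity of `orthErr` in the number of signals by inclusion of
events. -/
lemma detect_pulse_add {E : ℝ} {K K' k : ℕ} {z : ℕ → ℝ} (hk : k < K) (hK : K ≤ K')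
    (hz : z ∉ confusion E K' k) : detect K (fun i => pulse E k i + z i) = k := by
  refine detect_eq hk fun j hj hjk => ?_
  by_contra! h
  exact hz ⟨j, hj.trans_le hK, hjk, by simpa [pulse, hjk] using h⟩

/-! ### The variable-length separated code -/

/-- The number of messages in `{1, …, M}` of length `l`, for `l ≤ ⌊log₂ M⌋`. -/
def groupSize (M l : ℕ) : ℕ := min (2 ^ l) (M + 1 - 2 ^ l)

lemma groupSize_le (M l : ℕ) : groupSize M l ≤ 2 ^ l := min_le_left _ _

lemma index_lt_groupSize {M m : ℕ} (h1 : 1 ≤ m) (hM : m ≤ M) :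
    m - 2 ^ Nat.log 2 m < groupSize M (Nat.log 2 m) := by
  have h2 := Nat.pow_log_le_self 2 (x := m) (by omega)
  have h3 := Nat.lt_pow_succ_log_self (b := 2) (by norm_num) m
  rw [pow_succ] at h3
  exact lt_min (by omega) (by omega)

/-- The estimate of the length from the first `⌊log₂ M⌋ + 1` outputs. -/
def lengthEstimate (M : ℕ) (y : ℕ → ℝ) : ℕ := detect (Nat.log 2 M + 1) y

/-- The estimate of the index from the outputs after the first `⌊log₂ M⌋ + 1`. -/
def indexEstimate (M l : ℕ) (y : ℕ → ℝ) : ℕ := detect (groupSize M l) y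

lemma indexEstimate_lt (M l : ℕ) (y : ℕ → ℝ) : indexEstimate M l y < 2 ^ l := by
  have h1 : indexEstimate M l y ≤ groupSize M l - 1 := detect_le _ _
  have h2 := groupSize_le M l
  have h3 := Nat.two_pow_pos l
  omega

/-- The estimate of the message. -/
def messageEstimate (M : ℕ) (y : ℕ → ℝ) : ℕ :=
  2 ^ lengthEstimate M y +
    indexEstimate M (lengthEstimate M y) (fun i => y (Nat.log 2 M + 1 + i))

/-- The last group may be incomplete; the truncation in `groupSize` keeps the decoded value at most
`M` there. -/
lemma messageEstimate_mem {M : ℕ} (hM : 1 ≤ M) (y : ℕ → ℝ) :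
    messageEstimate M y ∈ Set.Icc 1 M := by
  have hl : lengthEstimate M y ≤ Nat.log 2 M := by
    have : lengthEstimate M y ≤ Nat.log 2 M + 1 - 1 := detect_le _ _
    omega
  have h1 : 2 ^ lengthEstimate M y ≤ M := Nat.pow_le_of_le_log (by omega) hl
  have h2 : indexEstimate M (lengthEstimate M y) (fun i => y (Nat.log 2 M + 1 + i)) ≤
      groupSize M (lengthEstimate M y) - 1 := detect_le _ _
  have h3 : groupSize M (lengthEstimate M y) ≤ M + 1 - 2 ^ lengthEstimate M y := min_le_right _ _
  have h4 := Nat.two_pow_pos (lengthEstimate M y)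
  unfold messageEstimate
  constructor <;> omega

lemma measurable_messageEstimate (M : ℕ) : Measurable (messageEstimate M) := by
  have h : Measurable fun p : ℕ × (ℕ → ℝ) => 2 ^ p.1 + indexEstimate M p.1 p.2 :=
    measurable_from_prod_countable_right fun l =>
      Measurable.add (f := fun _ => 2 ^ l) measurable_const (measurable_detect (groupSize M l))
  exact h.comp ((measurable_detect _).prodMk (measurable_pi_lambda _ fun i => measurable_pi_apply _))

/-- The code that sends the length and then the index by orthogonal signals of energies `E₂` and
`E₁`. -/
def separatedCode (E₁ E₂ : ℝ) {M : ℕ} (hM : 1 ≤ M) : Code (Set.Icc 1 M) where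
  encoder i m :=
    if i < Nat.log 2 M + 1 then pulse E₂ (Nat.log 2 m) i
    else pulse E₁ (m - 2 ^ Nat.log 2 m) (i - (Nat.log 2 M + 1))
  decoder y := ⟨messageEstimate M y, messageEstimate_mem hM y⟩
  measurable_encoder _ := .of_discrete
  measurable_decoder := (measurable_messageEstimate M).subtype_mk

section

variable {E₁ E₂ : ℝ} {M : ℕ} (hM : 1 ≤ M)

lemma separatedCode_encoder_of_lt (m : Set.Icc 1 M) {i : ℕ} (hi : i < Nat.log 2 M + 1) :
    (separatedCode E₁ E₂ hM).encoder i m = pulse E₂ (Nat.log 2 m) i :=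
  if_pos hi

lemma separatedCode_encoder_add (m : Set.Icc 1 M) (i : ℕ) :
    (separatedCode E₁ E₂ hM).encoder (Nat.log 2 M + 1 + i) m =
      pulse E₁ (m - 2 ^ Nat.log 2 m) i := by
  change ite _ _ _ = _
  rw [if_neg (by omega), Nat.add_sub_cancel_left]

lemma hasSum_separatedCode_encoder_sq (hE₁ : 0 ≤ E₁) (m : Set.Icc 1 M) :
    HasSum (fun i => (separatedCode E₁ E₂ hM).encoder (Nat.log 2 M + 1 + i) m ^ 2) E₁ := by
  simpa only [separatedCode_encoder_add] using hasSum_pulse_sq hE₁ _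

lemma sum_separatedCode_encoder_sq_le (hE₂ : 0 ≤ E₂) (m : Set.Icc 1 M) :
    ∑ i ∈ Finset.range (Nat.log 2 M + 1), (separatedCode E₁ E₂ hM).encoder i m ^ 2 ≤ E₂ := by
  rw [Finset.sum_congr rfl fun i hi => by
    rw [separatedCode_encoder_of_lt hM m (Finset.mem_range.1 hi)]]
  exact sum_le_hasSum _ (fun i _ => sq_nonneg _) (hasSum_pulse_sq hE₂ _)

lemma separatedCode_energyAtMost (hE₁ : 0 ≤ E₁) (hE₂ : 0 ≤ E₂) {E : ℝ} (hE : E₁ + E₂ ≤ E)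
    (P : Measure (Set.Icc 1 M)) : (separatedCode E₁ E₂ hM).EnergyAtMost P E := by
  refine Filter.Eventually.of_forall fun m => ?_
  have htail := hasSum_separatedCode_encoder_sq (E₂ := E₂) hM hE₁ m
  have htotal := (hasSum_nat_add_iff (Nat.log 2 M + 1)
    (f := fun i => (separatedCode E₁ E₂ hM).encoder i m ^ 2)).1
      (htail.congr_fun fun i => by rw [add_comm])
  refine ⟨htotal.summable, ?_⟩
  rw [htotal.tsum_eq]
  linarith [sum_separatedCode_encoder_sq_le (E₁ := E₁) hM hE₂ m]

lemma separatedCode_isVariableLengthSeparated (hE₁ : 0 ≤ E₁) (hE₂ : 0 ≤ E₂) :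
    (separatedCode E₁ E₂ hM).IsVariableLengthSeparated E₁ E₂ := by
  refine ⟨Nat.log 2 M + 1, pulse E₂, fun _ k i => pulse E₁ k i,
    -- Padding by `0` is harmless: `lengthEstimate` reads only the first `⌊log₂ M⌋ + 1` coordinates.
    fun v => lengthEstimate M fun i => if h : i < Nat.log 2 M + 1 then v ⟨i, h⟩ else 0,
    indexEstimate M, ?_, fun l => measurable_detect _,
    fun m i hi => separatedCode_encoder_of_lt hM m hi, separatedCode_encoder_add hM,
    sum_separatedCode_encoder_sq_le hM hE₂, fun m => ?_, indexEstimate_lt M, fun y => ?_⟩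
  · refine (measurable_detect _).comp (measurable_pi_lambda _ fun i => ?_)
    split_ifs
    · exact measurable_pi_apply _
    · exact measurable_const
  · have h := hasSum_separatedCode_encoder_sq (E₂ := E₂) hM hE₁ m
    exact ⟨h.summable, h.tsum_eq.le⟩
  · have h : lengthEstimate M (fun i => if i < Nat.log 2 M + 1 then y i else 0) =
        lengthEstimate M y := detect_congr fun j hj => if_pos hj
    simp only [dite_eq_ite, h]
    rfl

lemma separatedCode_decoder_output {m : Set.Icc 1 M} {z : ℕ → ℝ}
    (hlen : z ∉ confusion E₂ (Nat.log 2 M + 1) (Nat.log 2 m))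
    (hidx : (fun i => z (Nat.log 2 M + 1 + i)) ∉ confusion E₁ m (m - 2 ^ Nat.log 2 m)) :
    (separatedCode E₁ E₂ hM).decoder ((separatedCode E₁ E₂ hM).output m z) = m := by
  have hm := m.2
  have hpow : 2 ^ Nat.log 2 (m : ℕ) ≤ (m : ℕ) := Nat.pow_log_le_self 2 (by have := hm.1; omega)
  have hl : lengthEstimate M ((separatedCode E₁ E₂ hM).output m z) = Nat.log 2 m := by
    rw [← detect_pulse_add (Nat.lt_succ_of_le (Nat.log_mono_right hm.2)) le_rfl hlen]
    refine detect_congr fun j hj => ?_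
    rw [Code.output, separatedCode_encoder_of_lt hM m hj]
  have hk : indexEstimate M (Nat.log 2 m) (fun i =>
      (separatedCode E₁ E₂ hM).output m z (Nat.log 2 M + 1 + i)) = m - 2 ^ Nat.log 2 (m : ℕ) := by
    simp only [Code.output, separatedCode_encoder_add]
    exact detect_pulse_add (index_lt_groupSize hm.1 hm.2) ((groupSize_le _ _).trans hpow) hidx
  apply Subtype.ext
  change messageEstimate M _ = m
  rw [messageEstimate, hl, hk]
  omega

lemma separatedCode_conditional_error_le {N₀ : ℝ} (hN₀ : 0 < N₀) (m : Set.Icc 1 M) :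
    (noise N₀).real {z | (separatedCode E₁ E₂ hM).decoder
        ((separatedCode E₁ E₂ hM).output m z) ≠ m} ≤
      orthErr N₀ E₁ m + orthErr N₀ E₂ (Nat.log 2 M + 1) := by
  have hm := m.2
  have hl : Nat.log 2 (m : ℕ) < Nat.log 2 M + 1 := Nat.lt_succ_of_le (Nat.log_mono_right hm.2)
  have hk : (m : ℕ) - 2 ^ Nat.log 2 (m : ℕ) < m :=
    Nat.sub_lt hm.1 (Nat.two_pow_pos _)
  have hshift : Measurable fun (z : ℕ → ℝ) i => z (Nat.log 2 M + 1 + i) :=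
    measurable_pi_lambda _ fun i => measurable_pi_apply _
  rw [← noise_real_confusion hN₀ E₂ hl, ← noise_real_confusion hN₀ E₁ hk,
    -- Only the index event is to be pulled back along the shift; the final rewrite restores the
    -- other copies of the noise law.
    ← noise_map_add_left N₀ (Nat.log 2 M + 1),
    map_measureReal_apply hshift (measurableSet_confusion _ _ _), noise_map_add_left]
  refine (measureReal_mono fun z hz => ?_).trans (measureReal_union_le _ _)
  by_contra h
  rw [Set.mem_union, not_or] at h
  exact hz (separatedCode_decoder_output hM h.2 h.1)

lemma separatedCode_errorProb_le {N₀ : ℝ} (hN₀ : 0 < N₀) (P : Measure (Set.Icc 1 M))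
    [IsProbabilityMeasure P] :
    (separatedCode E₁ E₂ hM).errorProb P N₀ ≤
      (∫ m, orthErr N₀ E₁ m ∂P) + orthErr N₀ E₂ (Nat.log 2 M + 1) := by
  set c := separatedCode E₁ E₂ hM
  have hout : Measurable fun p : Set.Icc 1 M × (ℕ → ℝ) => c.output p.1 p.2 :=
    measurable_pi_lambda _ fun i => ((c.measurable_encoder i).comp measurable_fst).add
      ((measurable_pi_apply i).comp measurable_snd)
  have hS : MeasurableSet {p : Set.Icc 1 M × (ℕ → ℝ) | c.decoder (c.output p.1 p.2) ≠ p.1} :=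
    (measurableSet_eq_fun (c.measurable_decoder.comp hout) measurable_fst).compl
  calc c.errorProb P N₀
      = ∫ m, (noise N₀).real {z | c.decoder (c.output m z) ≠ m} ∂P := by
        rw [Code.errorProb, measureReal_def, Measure.prod_apply hS, ← integral_toReal
          (measurable_measure_prodMk_left hS).aemeasurable
          (Filter.Eventually.of_forall fun x => measure_lt_top _ _)]
        rfl
    _ ≤ ∫ m, (orthErr N₀ E₁ m + orthErr N₀ E₂ (Nat.log 2 M + 1)) ∂P :=
        integral_mono .of_finite .of_finite fun m => separatedCode_conditional_error_le hM hN₀ m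
    _ = _ := by
        rw [integral_add .of_finite .of_finite]
        simp

end

end EnergyLimited

end

theorem theorem8 {Ω : Type*} [MeasurableSpace Ω] (μ : Measure Ω) [IsProbabilityMeasure μ]
    (M : ℕ) (W : Ω → Set.Icc 1 M) (hW : Measurable W)
    (N₀ E E₁ E₂ : ℝ) (hN₀ : 0 < N₀) (hE₁ : 0 < E₁) (hE₂ : 0 < E₂) (hE : E₁ + E₂ ≤ E) :
    ∃ ε : ℝ,
      ε ≤ (∫ ω, EnergyLimited.orthErr N₀ E₁ (W ω) ∂μ) +
        EnergyLimited.orthErr N₀ E₂ (Nat.log 2 M + 1) ∧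
      ∃ c : EnergyLimited.Code (Set.Icc 1 M),
        c.IsEnergyErrorCode (μ.map W) N₀ E ε ∧ c.IsVariableLengthSeparated E₁ E₂ := by
  -- A sample point yields a message, hence `1 ≤ M`.
  obtain ⟨ω⟩ := nonempty_of_isProbabilityMeasure μ
  have hM : 1 ≤ M := (W ω).2.1.trans (W ω).2.2
  have := Measure.isProbabilityMeasure_map hW.aemeasurable (μ := μ)
  refine ⟨_, le_rfl, EnergyLimited.separatedCode E₁ E₂ hM, ⟨?_, ?_⟩, ?_⟩
  · exact EnergyLimited.separatedCode_energyAtMost hM hE₁.le hE₂.le hE _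
  · have h := EnergyLimited.separatedCode_errorProb_le (E₁ := E₁) (E₂ := E₂) hM hN₀ (μ.map W)
    rwa [integral_map hW.aemeasurable Measurable.of_discrete.aestronglyMeasurable] at h
  · exact EnergyLimited.separatedCode_isVariableLengthSeparated hM hE₁.le hE₂.le
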